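/- Let $N\ge 1$ and $k\ge 0$ be integers and let $X$ be a random $N\times k$ complex matrix whose rows $\vec X^{(1)},\dots,\vec X^{(N)}$ are independent random (row) vectors in $\mathbb C^k$ (for example, the first $k$ columns of an $N\times N$ complex standard Gaussian matrix). Let $$\Sigma := \frac1N X^\dagger X = \frac1N\sum_{p=1}^N (\vec X^{(p)})^\dagger \vec X^{(p)}$$ be the empirical covariance matrix. Then, for every $\mu\in\mathbb R$, $$\mathbb E\big(\operatorname{Tr} e^{\mu(\Sigma-\mathbb I_k)}\big)\;\le\; k\prod_{p=1}^N \Big\|\,\mathbb E\big(e^{\mu((\vec X^{(p)})^\dagger \vec X^{(p)}-\mathbb I_k)/N}\big)\Big\|_{\rm op}.$$ Here $\|\cdot\|_{\rm op}$ is the operator norm with respect to the Euclidean norm on $\mathbb C^k$, both sides are read in $[0,\infty]$, and a factor on the right is taken to be $+\infty$ if the random positive definite matrix in it is not integrable (with $0\cdot\infty=0$, which matters only for $k=0$). If all $N$ matrices $e^{\mu((\vec X^{(p)})^\dagger \vec X^{(p)}-\mathbb I_k)/N}$ are integrable, then $\operatorname{Tr} e^{\mu(\Sigma-\mathbb I_k)}$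 is integrable too, and the inequality holds between real numbers. -/

import Mathlib

open MeasureTheory ProbabilityTheory
open scoped Matrix ENNReal

noncomputable section

/-- The empirical covariance matrix `Σ = (1/N) X† X` of an `N × k` complex matrix `X`. -/
def empiricalCovariance {N k : ℕ} (X : Matrix (Fin N) (Fin k) ℂ) : Matrix (Fin k) (Fin k) ℂ :=
  (N : ℂ)⁻¹ • (Xᴴ * X)

/-- The rank-one matrix `v† v` of a row vector `v`, with entries `conj (v i) * v j`. -/
def rankOne {k : ℕ} (v : Fin k → ℂ) : Matrix (Fin k) (Fin k) ℂ :=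
  Matrix.vecMulVec (star v) v

/-- The operator norm of a square complex matrix with respect to the Euclidean norm. -/
def matrixOpNorm {k : ℕ} (A : Matrix (Fin k) (Fin k) ℂ) : ℝ :=
  ‖Matrix.toEuclideanCLM (n := Fin k) (𝕜 := ℂ) A‖

/-- A random matrix is integrable when each of its entries is. -/
def MatrixIntegrable {Ω : Type*} [MeasurableSpace Ω] {k : ℕ}
    (M : Ω → Matrix (Fin k) (Fin k) ℂ) (P : Measure Ω) : Prop :=
  ∀ i j, Integrable (fun ω => M ω i j) P

/-- The entrywise expectation of a random matrix. -/
def matrixExpectation {Ω : Type*} [MeasurableSpace Ω] {k : ℕ}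
    (M : Ω → Matrix (Fin k) (Fin k) ℂ) (P : Measure Ω) : Matrix (Fin k) (Fin k) ℂ :=
  Matrix.of fun i j => ∫ ω, M ω i j ∂P

open Classical in
/-- The quantity `‖E M‖_op` in `[0, ∞]`: the operator norm of the expectation if `M` is integrable
and `∞` otherwise. It is applied to random positive definite matrices only, for which
non-integrability means that the trace has infinite expectation. -/
def expectationOpNorm {Ω : Type*} [MeasurableSpace Ω] {k : ℕ}
    (M : Ω → Matrix (Fin k) (Fin k) ℂ) (P : Measure Ω) : ℝ≥0∞ :=
  if MatrixIntegrable M P then ENNReal.ofReal (matrixOpNorm (matrixExpectation M P)) else ⊤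

/-- The real number `Tr e^{μ (Σ - I)}` for the empirical covariance matrix `Σ` of `X`; the
exponent is Hermitian, so that the trace is real and positive. -/
def traceExpCov {N k : ℕ} (μ : ℝ) (X : Matrix (Fin N) (Fin k) ℂ) : ℝ :=
  (Matrix.trace (NormedSpace.exp ((μ : ℂ) • (empiricalCovariance X - 1)))).re

/-- The matrix `e^{μ (v† v - I) / N}` for a row vector `v`. -/
def expRankOne {k : ℕ} (N : ℕ) (μ : ℝ) (v : Fin k → ℂ) : Matrix (Fin k) (Fin k) ℂ :=
  NormedSpace.exp ((μ : ℂ) • ((N : ℂ)⁻¹ • (rankOne v - 1)))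

end

/-! ### The Lie product formula. -/

section LieProduct

open Filter Topology NormedSpace

/-! The exponent `μ (Σ - I)` is a sum of independent Hermitian matrices, one per row. Let `S` be a
partial sum and `A` the next summand. Golden–Thompson gives `Tr e^(S+A) ≤ Tr (e^S e^A)`;
independence replaces `e^A` by its mean `C` under the expectation; and `Tr (e^S C) ≤ ‖C‖ Tr e^S`
(`trace_exp_mul_re_le`). Peeling off all summands ends at `Tr I = k`.

Golden–Thompson follows from the Lie product formula along powers of two and from `|Tr (AB)^(2^m)| ≤
|Tr (A^(2^m) B^(2^m))|`, which rests only on Cauchy–Schwarz (`Matrix.trace_pow_two_pow_bounds`). -/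

theorem norm_pow_sub_pow_le_of_norm_le {𝔸 : Type*} [NormedRing 𝔸] {a b : 𝔸} {M : ℝ} (hM : 0 ≤ M)
    (ha : ‖a‖ ≤ M) (hb : ‖b‖ ≤ M) (n : ℕ) :
    ‖a ^ (n + 1) - b ^ (n + 1)‖ ≤ (n + 1) * M ^ n * ‖a - b‖ := by
  induction n with
  | zero => simp
  | succ n ih =>
    have hbn : ‖b ^ (n + 1)‖ ≤ M ^ (n + 1) :=
      (norm_pow_le' b n.succ_pos).trans (pow_le_pow_left₀ (norm_nonneg _) hb _)
    have e : a ^ (n + 1 + 1) - b ^ (n + 1 + 1)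
        = a * (a ^ (n + 1) - b ^ (n + 1)) + (a - b) * b ^ (n + 1) := by
      rw [pow_succ' a (n + 1), pow_succ' b (n + 1)]; noncomm_ring
    calc ‖a ^ (n + 1 + 1) - b ^ (n + 1 + 1)‖
        ≤ ‖a‖ * ‖a ^ (n + 1) - b ^ (n + 1)‖ + ‖a - b‖ * ‖b ^ (n + 1)‖ := by
          rw [e]
          exact (norm_add_le _ _).trans (add_le_add (norm_mul_le _ _) (norm_mul_le _ _))
      _ ≤ M * ((n + 1) * M ^ n * ‖a - b‖) + ‖a - b‖ * M ^ (n + 1) := by gcongr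
      _ = _ := by push_cast; ring

variable {𝔸 : Type*} [NormedRing 𝔸] [NormedAlgebra ℝ 𝔸]

/-- Asking for `‖1‖ ≤ 1` instead of `‖1‖ = 1` admits the zero ring of `0 × 0` matrices. -/
theorem norm_exp_le_exp_norm_of_norm_one_le (h1 : ‖(1 : 𝔸)‖ ≤ 1) (x : 𝔸) :
    ‖NormedSpace.exp x‖ ≤ Real.exp ‖x‖ := by
  rw [NormedSpace.exp_eq_tsum ℝ, Real.exp_eq_exp_ℝ, NormedSpace.exp_eq_tsum ℝ]
  refine tsum_of_norm_bounded (NormedSpace.expSeries_summable' (𝕂 := ℝ) ‖x‖).hasSum fun n => ?_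
  rw [norm_smul, Real.norm_of_nonneg (by positivity), smul_eq_mul]
  gcongr
  rcases n.eq_zero_or_pos with rfl | hn
  · simpa using h1
  · exact norm_pow_le' x hn

/-- The Lie product formula. -/
theorem tendsto_exp_mul_exp_pow [CompleteSpace 𝔸] (h1 : ‖(1 : 𝔸)‖ ≤ 1) (x y : 𝔸) :
    Tendsto (fun n : ℕ => (NormedSpace.exp (((n : ℝ) + 1)⁻¹ • x) *
      NormedSpace.exp (((n : ℝ) + 1)⁻¹ • y)) ^ (n + 1)) atTop (𝓝 (NormedSpace.exp (x + y))) := by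
  -- The difference of the two curves is `o(t)` at `0`, which beats the factor `n + 1` lost in
  -- comparing `(n + 1)`-th powers.
  have hd : HasDerivAt (fun t : ℝ => NormedSpace.exp (t • x) * NormedSpace.exp (t • y)
      - NormedSpace.exp (t • (x + y))) 0 0 := by
    have h (z : 𝔸) : HasDerivAt (fun t : ℝ => NormedSpace.exp (t • z)) z 0 := by
      simpa using hasDerivAt_exp_smul_const (𝕂 := ℝ) z (0 : ℝ)
    simpa [-smul_add] using ((h x).fun_mul (h y)).fun_sub (h (x + y))
  have hs : Tendsto (fun n : ℕ => ((n : ℝ) + 1)⁻¹) atTop (𝓝[≠] 0) := by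
    refine tendsto_nhdsWithin_iff.2 ⟨by simpa using tendsto_one_div_add_atTop_nhds_zero_nat (𝕜 := ℝ),
      Eventually.of_forall fun n => ?_⟩
    simp only [Set.mem_compl_iff, Set.mem_singleton_iff]
    positivity
  have hz := ((hasDerivAt_iff_tendsto_slope_zero.1 hd).comp hs).norm.const_mul
    (Real.exp (‖x‖ + ‖y‖))
  rw [tendsto_iff_norm_sub_tendsto_zero]
  refine squeeze_zero (fun _ => norm_nonneg _) (fun n => ?_) (by simpa [Function.comp_def, norm_smul, -smul_add] using hz)
  set s : ℝ := ((n : ℝ) + 1)⁻¹ with hsdef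
  have hs0 : 0 ≤ s := by positivity
  have hs1 : ((n : ℝ) + 1) * s = 1 := by rw [hsdef]; field_simp
  have hexp : NormedSpace.exp (x + y) = NormedSpace.exp (s • (x + y)) ^ (n + 1) := by
    let : NormedAlgebra ℚ 𝔸 := NormedAlgebra.restrictScalars ℚ ℝ 𝔸
    rw [← NormedSpace.exp_nsmul, ← Nat.cast_smul_eq_nsmul ℝ, smul_smul]
    push_cast
    rw [hs1, one_smul]
  have hM : Real.exp (s * (‖x‖ + ‖y‖)) ^ n ≤ Real.exp (‖x‖ + ‖y‖) := by
    rw [← Real.exp_nat_mul, ← mul_assoc]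
    refine Real.exp_le_exp.2 (mul_le_of_le_one_left (by positivity) ?_)
    nlinarith
  have hx := norm_exp_le_exp_norm_of_norm_one_le h1 (s • x)
  have hy := norm_exp_le_exp_norm_of_norm_one_le h1 (s • y)
  have hxy := norm_exp_le_exp_norm_of_norm_one_le h1 (s • (x + y))
  rw [norm_smul, Real.norm_of_nonneg hs0] at hx hy hxy
  rw [hexp]
  refine (norm_pow_sub_pow_le_of_norm_le (M := Real.exp (s * (‖x‖ + ‖y‖))) (by positivity)
    ?_ ?_ n).trans ?_
  · refine (norm_mul_le _ _).trans ((mul_le_mul hx hy (norm_nonneg _) (by positivity)).trans ?_)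
    rw [← Real.exp_add, mul_add]
  · refine hxy.trans (Real.exp_le_exp.2 ?_)
    gcongr
    exact norm_add_le x y
  · rw [abs_of_nonneg (by positivity : (0 : ℝ) ≤ (n : ℝ) + 1)]
    calc _ ≤ ((n : ℝ) + 1) * Real.exp (‖x‖ + ‖y‖) * _ := by gcongr
      _ = _ := by ring

end LieProduct

/-! ### The Golden–Thompson inequality. -/

section GoldenThompson

open Matrix

variable {n : Type*} [Fintype n]

theorem Matrix.trace_mul_conjTranspose_self_eq_sum (A : Matrix n n ℂ) :
    (A * Aᴴ).trace = ((∑ i, ∑ j, ‖A i j‖ ^ 2 : ℝ) : ℂ) := by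
  simp [Matrix.trace, Matrix.mul_apply, Complex.mul_conj, Complex.normSq_eq_norm_sq]

/-- Cauchy–Schwarz for the Hilbert–Schmidt inner product. -/
theorem Matrix.norm_trace_mul_le (A B : Matrix n n ℂ) :
    ‖(A * B).trace‖ ≤ √((A * Aᴴ).trace.re) * √((B * Bᴴ).trace.re) := by
  rw [trace_mul_conjTranspose_self_eq_sum, trace_mul_conjTranspose_self_eq_sum,
    Complex.ofReal_re, Complex.ofReal_re, Finset.sum_comm (f := fun i j => ‖B i j‖ ^ 2)]
  simp only [← Fintype.sum_prod_type']
  refine le_trans ?_ (Real.sum_mul_le_sqrt_mul_sqrt Finset.univ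
    (fun p : n × n => ‖A p.1 p.2‖) (fun p : n × n => ‖B p.2 p.1‖))
  simp only [Matrix.trace, Matrix.diag, Matrix.mul_apply, ← Fintype.sum_prod_type']
  exact (norm_sum_le _ _).trans (Finset.sum_le_sum fun p _ => (norm_mul_le _ _))

variable [DecidableEq n]

theorem Matrix.trace_mul_pow_comm (A B : Matrix n n ℂ) (m : ℕ) :
    ((A * B) ^ m).trace = ((B * A) ^ m).trace := by
  cases m with
  | zero => simp
  | succ m =>
    rw [pow_succ', mul_assoc, ← mul_pow_mul, trace_mul_comm, pow_succ, mul_assoc]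

/-- The two bounds feed each other in a joint induction. The first, at `X ^ 2`, leads to the second
for the pair `Xᴴ * X`, `X * Xᴴ`, and Cauchy–Schwarz closes. The first, at `A * B`, leads by
cyclicity to the second for `A ^ 2`, `B ^ 2`. -/
theorem Matrix.trace_pow_two_pow_bounds (m : ℕ) :
    (∀ X : Matrix n n ℂ, ‖(X ^ 2 ^ (m + 1)).trace‖ ≤ ((X * Xᴴ) ^ 2 ^ m).trace.re) ∧
    (∀ A B : Matrix n n ℂ, A.IsHermitian → B.IsHermitian →
      ‖((A * B) ^ 2 ^ m).trace‖ ≤ ‖(A ^ 2 ^ m * B ^ 2 ^ m).trace‖) := by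
  induction m with
  | zero =>
    refine ⟨fun X => ?_, fun A B _ _ => by simp⟩
    have h := norm_trace_mul_le X X
    rw [Real.mul_self_sqrt (by
      rw [trace_mul_conjTranspose_self_eq_sum, Complex.ofReal_re]; positivity)] at h
    simpa [pow_two] using h
  | succ m ih =>
    obtain ⟨hP, hG⟩ := ih
    refine ⟨fun X => ?_, fun A B hA hB => ?_⟩
    · have hp : (Xᴴ * X).IsHermitian := isHermitian_conjTranspose_mul_self X
      have hq : (X * Xᴴ).IsHermitian := isHermitian_mul_conjTranspose_self X
      have e1 : ((X ^ 2 * (X ^ 2)ᴴ) ^ 2 ^ m).trace = ((Xᴴ * X * (X * Xᴴ)) ^ 2 ^ m).trace := by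
        rw [show X ^ 2 * (X ^ 2)ᴴ = X * (X * Xᴴ * Xᴴ) by
          simp only [pow_two, conjTranspose_mul, mul_assoc], trace_mul_pow_comm,
          show X * Xᴴ * Xᴴ * X = X * Xᴴ * (Xᴴ * X) by simp only [mul_assoc], trace_mul_pow_comm]
      have e2 (Y : Matrix n n ℂ) (hY : Y.IsHermitian) :
          Y ^ 2 ^ m * (Y ^ 2 ^ m)ᴴ = Y ^ 2 ^ (m + 1) := by
        rw [conjTranspose_pow, hY.eq, ← pow_add, pow_succ, mul_two]
      have h1 := hP (X ^ 2)
      rw [← pow_mul, ← pow_succ', e1] at h1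
      have h3 := norm_trace_mul_le ((Xᴴ * X) ^ 2 ^ m) ((X * Xᴴ) ^ 2 ^ m)
      rw [e2 _ hp, e2 _ hq, trace_mul_pow_comm Xᴴ X, Real.mul_self_sqrt (by
        rw [← e2 _ hq, trace_mul_conjTranspose_self_eq_sum, Complex.ofReal_re]; positivity)] at h3
      exact h1.trans ((Complex.re_le_norm _).trans ((hG _ _ hp hq).trans h3))
    · have h1 := hP (A * B)
      have e1 : ((A * B * (A * B)ᴴ) ^ 2 ^ m).trace = ((A ^ 2 * B ^ 2) ^ 2 ^ m).trace := by
        rw [conjTranspose_mul, hA.eq, hB.eq, show A * B * (B * A) = A * (B ^ 2 * A) by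
          simp only [pow_two, mul_assoc], trace_mul_pow_comm, mul_assoc, ← pow_two,
          trace_mul_pow_comm]
      rw [e1] at h1
      refine h1.trans ((Complex.re_le_norm _).trans ((hG _ _ (hA.pow 2) (hB.pow 2)).trans ?_))
      rw [← pow_mul, ← pow_mul, ← pow_succ']

theorem Matrix.trace_exp_mul_self_eq {A : Matrix n n ℂ} (hA : A.IsHermitian) :
    ∃ R : Matrix n n ℂ, R.IsHermitian ∧ IsUnit R ∧ NormedSpace.exp A = R * R := by
  refine ⟨NormedSpace.exp ((2 : ℝ)⁻¹ • A), ?_, isUnit_exp _, ?_⟩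
  · refine IsHermitian.exp ?_
    rw [IsHermitian, conjTranspose_smul, hA.eq]; simp
  · rw [← exp_add_of_commute _ _ (Commute.refl _), ← add_smul]
    norm_num

open scoped Matrix.Norms.L2Operator in
theorem Matrix.l2_opNorm_one_le : ‖(1 : Matrix n n ℂ)‖ ≤ 1 := by
  rw [← l2_opNorm_toEuclideanCLM, map_one]
  exact ContinuousLinearMap.norm_id_le

open scoped Matrix.Norms.L2Operator in
/-- The Golden–Thompson inequality. -/
theorem Matrix.trace_exp_add_re_le {A B : Matrix n n ℂ} (hA : A.IsHermitian)
    (hB : B.IsHermitian) :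
    (NormedSpace.exp (A + B)).trace.re ≤ (NormedSpace.exp A * NormedSpace.exp B).trace.re := by
  have hlim := (tendsto_exp_mul_exp_pow (l2_opNorm_one_le (n := n)) A B)
  -- The trace bound covers only exponents `2 ^ m`, so the limit is taken along `n + 1 = 2 ^ m`.
  have hsub : Filter.Tendsto (fun m : ℕ => 2 ^ m - 1) Filter.atTop Filter.atTop :=
    Filter.tendsto_atTop_mono (fun m => Nat.le_sub_one_of_lt m.lt_two_pow_self) Filter.tendsto_id
  have hc : Continuous fun M : Matrix n n ℂ => M.trace.re :=
    Complex.continuous_re.comp (continuous_id.matrix_trace)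
  refine le_of_tendsto ((hc.tendsto _).comp (hlim.comp hsub)) (Filter.Eventually.of_forall
    fun m => ?_)
  simp only [Function.comp_apply]
  have hm : 2 ^ m - 1 + 1 = 2 ^ m := Nat.sub_add_cancel Nat.one_le_two_pow
  rw [hm]
  set s : ℝ := (((2 ^ m - 1 : ℕ) : ℝ) + 1)⁻¹ with hs
  have hs1 : ((2 ^ m : ℕ) : ℝ) * s = 1 := by
    rw [hs, ← Nat.cast_add_one, hm]
    exact mul_inv_cancel₀ (by positivity)
  have hexp (Z : Matrix n n ℂ) : NormedSpace.exp (s • Z) ^ 2 ^ m = NormedSpace.exp Z := by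
    rw [← exp_nsmul, ← Nat.cast_smul_eq_nsmul ℝ, smul_smul, hs1, one_smul]
  have hherm {Z : Matrix n n ℂ} (hZ : Z.IsHermitian) : (NormedSpace.exp (s • Z)).IsHermitian := by
    refine IsHermitian.exp ?_
    rw [IsHermitian, conjTranspose_smul, hZ.eq]; simp
  have h := (trace_pow_two_pow_bounds m).2 _ _ (hherm hA) (hherm hB)
  rw [hexp, hexp] at h
  refine (Complex.re_le_norm _).trans (h.trans_eq ?_)
  obtain ⟨R, hR, -, eR⟩ := trace_exp_mul_self_eq hA
  obtain ⟨S, hS, -, eS⟩ := trace_exp_mul_self_eq hB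
  -- With Hermitian square roots `R`, `S` the trace is a sum of squares, so its norm equals its real
  -- part.
  have : (NormedSpace.exp A * NormedSpace.exp B).trace = ((R * S) * (R * S)ᴴ).trace := by
    rw [eR, eS, conjTranspose_mul, hR.eq, hS.eq, mul_assoc R, trace_mul_comm]
    simp only [mul_assoc]
  rw [this, trace_mul_conjTranspose_self_eq_sum, Complex.norm_of_nonneg (by positivity),
    Complex.ofReal_re]

end GoldenThompson

/-! ### Trace bounds and the matrix Laplace transform. -/

section MatrixLaplace

open Matrix

theorem Matrix.exists_exp_eq_mul_self_of_isHermitian {n : Type*} [Fintype n] [DecidableEq n]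
    {A : Matrix n n ℂ} (hA : A.IsHermitian) :
    ∃ R : Matrix n n ℂ, R.IsHermitian ∧ IsUnit R ∧ NormedSpace.exp A = R * R ∧
      (NormedSpace.exp A).trace.re = ∑ i, ∑ j, ‖R i j‖ ^ 2 := by
  obtain ⟨R, hR, hu, eR⟩ := trace_exp_mul_self_eq hA
  refine ⟨R, hR, hu, eR, ?_⟩
  have h := trace_mul_conjTranspose_self_eq_sum R
  rw [hR.eq] at h
  rw [eR, h, Complex.ofReal_re]

theorem Matrix.trace_exp_re_nonneg {n : Type*} [Fintype n] [DecidableEq n]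
    {A : Matrix n n ℂ} (hA : A.IsHermitian) : 0 ≤ (NormedSpace.exp A).trace.re := by
  obtain ⟨R, -, -, -, ht⟩ := exists_exp_eq_mul_self_of_isHermitian hA
  rw [ht]; positivity

/-- Integrability of all entries thus reduces to that of the trace. -/
theorem Matrix.norm_exp_apply_le_trace {n : Type*} [Fintype n] [DecidableEq n]
    {A : Matrix n n ℂ} (hA : A.IsHermitian) (i j : n) :
    ‖NormedSpace.exp A i j‖ ≤ (NormedSpace.exp A).trace.re := by
  obtain ⟨R, hR, -, eR, ht⟩ := exists_exp_eq_mul_self_of_isHermitian hA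
  have hrow (i : n) : ∑ l, ‖R i l‖ ^ 2 ≤ ∑ i, ∑ j, ‖R i j‖ ^ 2 :=
    Finset.single_le_sum (f := fun i => ∑ j, ‖R i j‖ ^ 2) (fun _ _ => by positivity)
      (Finset.mem_univ i)
  rw [ht, eR, mul_apply]
  calc ‖∑ l, R i l * R l j‖ ≤ ∑ l, ‖R i l‖ * ‖R j l‖ := by
        refine (norm_sum_le _ _).trans (Finset.sum_le_sum fun l _ => ?_)
        rw [norm_mul, ← hR.apply l j, norm_star]
    _ ≤ ∑ l, (‖R i l‖ ^ 2 + ‖R j l‖ ^ 2) / 2 :=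
        Finset.sum_le_sum fun l _ => by nlinarith [sq_nonneg (‖R i l‖ - ‖R j l‖)]
    _ ≤ _ := by
        rw [← Finset.sum_div, Finset.sum_add_distrib]
        linarith [hrow i, hrow j]

theorem Matrix.exp_apply_self_re_pos {n : Type*} [Fintype n] [DecidableEq n]
    {A : Matrix n n ℂ} (hA : A.IsHermitian) (i : n) : 0 < (NormedSpace.exp A i i).re := by
  obtain ⟨R, hR, hu, eR, -⟩ := exists_exp_eq_mul_self_of_isHermitian hA
  have h : (NormedSpace.exp A i i).re = ∑ l, ‖R i l‖ ^ 2 := by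
    rw [eR, mul_apply, Complex.re_sum]
    refine Finset.sum_congr rfl fun l _ => ?_
    rw [← hR.apply l i, Complex.star_def, Complex.mul_conj, Complex.ofReal_re,
      Complex.normSq_eq_norm_sq]
  rw [h]
  refine (Finset.sum_nonneg fun l _ => by positivity).lt_of_ne fun h0 => ?_
  have hz (l : n) : R i l = 0 := by
    have := (Finset.sum_eq_zero_iff_of_nonneg fun l _ => by positivity).1 h0.symm l
      (Finset.mem_univ l)
    simpa using this
  obtain ⟨S, hS⟩ := hu.exists_right_inv
  have := congrFun (congrFun hS i) i
  simp [mul_apply, hz] at this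

theorem norm_mulVec_sq_le {k : ℕ} (C : Matrix (Fin k) (Fin k) ℂ) (x : Fin k → ℂ) :
    ∑ i, ‖(C *ᵥ x) i‖ ^ 2 ≤ matrixOpNorm C ^ 2 * ∑ i, ‖x i‖ ^ 2 := by
  have h := (Matrix.toEuclideanCLM (n := Fin k) (𝕜 := ℂ) C).le_opNorm (WithLp.toLp 2 x)
  have h2 := pow_le_pow_left₀ (norm_nonneg _) h 2
  rw [mul_pow, EuclideanSpace.norm_sq_eq, EuclideanSpace.norm_sq_eq] at h2
  exact h2

theorem matrixOpNorm_nonneg {k : ℕ} (C : Matrix (Fin k) (Fin k) ℂ) : 0 ≤ matrixOpNorm C :=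
  norm_nonneg _

/-- With `exp A = R * R`, apply Cauchy–Schwarz to `R` and `C * R`, bounding the latter column by
column. -/
theorem trace_exp_mul_re_le {k : ℕ} {A : Matrix (Fin k) (Fin k) ℂ} (hA : A.IsHermitian)
    (C : Matrix (Fin k) (Fin k) ℂ) :
    (NormedSpace.exp A * C).trace.re ≤ (NormedSpace.exp A).trace.re * matrixOpNorm C := by
  obtain ⟨R, hR, -, eR, ht⟩ := exists_exp_eq_mul_self_of_isHermitian hA
  set F : ℝ := ∑ i, ∑ j, ‖R i j‖ ^ 2 with hF
  have hF0 : 0 ≤ F := by positivity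
  have hCR : ((C * R) * (C * R)ᴴ).trace.re ≤ matrixOpNorm C ^ 2 * F := by
    rw [trace_mul_conjTranspose_self_eq_sum, Complex.ofReal_re, Finset.sum_comm, hF,
      Finset.sum_comm (f := fun i j => ‖R i j‖ ^ 2), Finset.mul_sum]
    exact Finset.sum_le_sum fun j _ => norm_mulVec_sq_le C fun l => R l j
  have h := norm_trace_mul_le R (C * R)
  rw [trace_mul_conjTranspose_self_eq_sum R, Complex.ofReal_re, ← hF] at h
  rw [eR, mul_assoc, trace_mul_comm, mul_assoc, trace_mul_comm R, trace_mul_comm, ← eR, ht]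
  calc _ ≤ _ := (Complex.re_le_norm _).trans h
    _ ≤ √F * √(matrixOpNorm C ^ 2 * F) := by gcongr
    _ = F * matrixOpNorm C := by
        rw [Real.sqrt_mul (by positivity), Real.sqrt_sq (matrixOpNorm_nonneg C), mul_left_comm,
          Real.mul_self_sqrt hF0, mul_comm]

open scoped Matrix.Norms.L2Operator in
theorem Matrix.continuous_exp {n : Type*} [Fintype n] [DecidableEq n] :
    Continuous (NormedSpace.exp : Matrix n n ℂ → Matrix n n ℂ) := by
  let : NormedAlgebra ℚ (Matrix n n ℂ) := NormedAlgebra.restrictScalars ℚ ℝ _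
  exact NormedSpace.exp_continuous

theorem Matrix.measurable_exp_apply {n Ω : Type*} [Fintype n] [DecidableEq n] [MeasurableSpace Ω]
    {M : Ω → Matrix n n ℂ} (hM : ∀ i j, Measurable fun ω => M ω i j) (i j : n) :
    Measurable fun ω => NormedSpace.exp (M ω) i j := by
  have hc : Continuous fun f : n → n → ℂ => NormedSpace.exp (Matrix.of f) i j :=
    (continuous_exp.comp continuous_id).matrix_elem i j
  exact hc.measurable.comp (measurable_pi_lambda _ fun i => measurable_pi_lambda _ fun j => hM i j)

variable {Ω : Type*} [MeasurableSpace Ω] {P : Measure Ω}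

/-- Diagonal entries of the exponential are strictly positive, hence so are their means. This
excludes `0 * ∞` on the right-hand side when `k ≠ 0`. -/
theorem matrixOpNorm_matrixExpectation_exp_pos [NeZero P] {k : ℕ} (hk : k ≠ 0)
    {M : Ω → Matrix (Fin k) (Fin k) ℂ} (hM : ∀ ω, (M ω).IsHermitian)
    (hi : MatrixIntegrable (fun ω => NormedSpace.exp (M ω)) P) :
    0 < matrixOpNorm (matrixExpectation (fun ω => NormedSpace.exp (M ω)) P) := by
  refine (matrixOpNorm_nonneg _).lt_of_ne fun h0 => ?_
  have hz : matrixExpectation (fun ω => NormedSpace.exp (M ω)) P = 0 := by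
    rw [matrixOpNorm, eq_comm, norm_eq_zero] at h0
    exact (map_eq_zero_iff _ (Matrix.toEuclideanCLM (n := Fin k) (𝕜 := ℂ)).injective).1 h0
  let i : Fin k := ⟨0, Nat.pos_of_ne_zero hk⟩
  have h1 : ∫ ω, NormedSpace.exp (M ω) i i ∂P = 0 := congrFun (congrFun hz i) i
  have h2 : ∫ ω, (NormedSpace.exp (M ω) i i).re ∂P = 0 := by
    have := integral_re (hi i i)
    simpa [h1] using this
  rw [integral_eq_zero_iff_of_nonneg (fun ω => (exp_apply_self_re_pos (hM ω) i).le) (hi i i).re]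
    at h2
  obtain ⟨ω, hω⟩ := h2.exists
  exact (exp_apply_self_re_pos (hM ω) i).ne' hω

/-- The matrix Laplace transform bound for sums of independent random Hermitian matrices. -/
theorem integral_trace_exp_sum_le [IsProbabilityMeasure P] {ι 𝓧 : Type*} [MeasurableSpace 𝓧]
    {k : ℕ} {Y : ι → Ω → 𝓧} (hY : ∀ p, Measurable (Y p)) (hindep : iIndepFun Y P)
    {G : 𝓧 → Matrix (Fin k) (Fin k) ℂ} (hGm : ∀ i j, Measurable fun y => G y i j)
    (hG : ∀ y, (G y).IsHermitian)
    (hint : ∀ p, MatrixIntegrable (fun ω => NormedSpace.exp (G (Y p ω))) P) (s : Finset ι) :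
    MatrixIntegrable (fun ω => NormedSpace.exp (∑ p ∈ s, G (Y p ω))) P ∧
    ∫ ω, (NormedSpace.exp (∑ p ∈ s, G (Y p ω))).trace.re ∂P ≤
      k * ∏ p ∈ s, matrixOpNorm (matrixExpectation (fun ω => NormedSpace.exp (G (Y p ω))) P) := by
  classical
  have hsum (s : Finset ι) (ω : Ω) : (∑ p ∈ s, G (Y p ω)).IsHermitian :=
    isSelfAdjoint_sum s fun p _ => hG (Y p ω)
  have hms (s : Finset ι) (i j : Fin k) :
      Measurable fun ω => NormedSpace.exp (∑ p ∈ s, G (Y p ω)) i j := by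
    refine measurable_exp_apply (fun i j => ?_) i j
    simp only [Matrix.sum_apply]
    exact Finset.measurable_sum s fun p _ => (hGm i j).comp (hY p)
  induction s using Finset.induction_on with
  | empty =>
    simp [MatrixIntegrable]
  | insert q s hq ih =>
    obtain ⟨ihi, ihb⟩ := ih
    have hind (i j : Fin k) : IndepFun (fun ω => NormedSpace.exp (∑ p ∈ s, G (Y p ω)) i j)
        (fun ω => NormedSpace.exp (G (Y q ω)) j i) P := by
      have h := hindep.indepFun_finset s {q} (Finset.disjoint_singleton_right.2 hq) hY
      refine (h.comp (φ := fun y : s → 𝓧 => NormedSpace.exp (∑ p, G (y p)) i j)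
        (ψ := fun y : ({q} : Finset ι) → 𝓧 =>
          NormedSpace.exp (G (y ⟨q, Finset.mem_singleton_self q⟩)) j i)
        (measurable_exp_apply (fun i j => ?_) i j)
        (measurable_exp_apply (fun i j => (hGm i j).comp (measurable_pi_apply _)) j i)).congr
        (Filter.Eventually.of_forall fun ω => ?_) (Filter.Eventually.of_forall fun ω => rfl)
      · simp only [Matrix.sum_apply]
        exact Finset.measurable_sum _ fun p _ => (hGm i j).comp (measurable_pi_apply p)
      · simp only [Function.comp_apply]
        rw [Finset.sum_coe_sort s fun p => G (Y p ω)]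
    have hmul (i j : Fin k) : Integrable (fun ω => NormedSpace.exp (∑ p ∈ s, G (Y p ω)) i j *
        NormedSpace.exp (G (Y q ω)) j i) P := (hind i j).integrable_mul (ihi i j) (hint q j i)
    set C := matrixExpectation (fun ω => NormedSpace.exp (G (Y q ω))) P with hC
    have htr (ω : Ω) (B : Matrix (Fin k) (Fin k) ℂ) :
        (NormedSpace.exp (∑ p ∈ s, G (Y p ω)) * B).trace =
          ∑ i, ∑ j, NormedSpace.exp (∑ p ∈ s, G (Y p ω)) i j * B j i := by
      simp [Matrix.trace, Matrix.mul_apply]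
    have hprod : Integrable (fun ω => (NormedSpace.exp (∑ p ∈ s, G (Y p ω)) *
        NormedSpace.exp (G (Y q ω))).trace) P := by
      simp only [htr]
      exact integrable_finsetSum _ fun i _ => integrable_finsetSum _ fun j _ => hmul i j
    have hconst : Integrable (fun ω => (NormedSpace.exp (∑ p ∈ s, G (Y p ω)) * C).trace) P := by
      simp only [htr]
      exact integrable_finsetSum _ fun i _ => integrable_finsetSum _ fun j _ =>
        (ihi i j).mul_const _
    -- Independence is used entry by entry: the trace is a finite sum of products of independent
    -- integrable variables.
    have hE : ∫ ω, (NormedSpace.exp (∑ p ∈ s, G (Y p ω)) * NormedSpace.exp (G (Y q ω))).trace ∂P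
        = ∫ ω, (NormedSpace.exp (∑ p ∈ s, G (Y p ω)) * C).trace ∂P := by
      simp only [htr]
      rw [integral_finsetSum _ fun i _ => integrable_finsetSum _ fun j _ => hmul i j,
        integral_finsetSum _ fun i _ => integrable_finsetSum _ fun j _ => (ihi i j).mul_const _]
      refine Finset.sum_congr rfl fun i _ => ?_
      rw [integral_finsetSum _ fun j _ => hmul i j,
        integral_finsetSum _ fun j _ => (ihi i j).mul_const _]
      refine Finset.sum_congr rfl fun j _ => ?_
      rw [(hind i j).integral_fun_mul_eq_mul_integral (ihi i j).1 (hint q j i).1,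
        integral_mul_const]
      rfl
    have hgt (ω : Ω) : (NormedSpace.exp (∑ p ∈ insert q s, G (Y p ω))).trace.re ≤
        (NormedSpace.exp (∑ p ∈ s, G (Y p ω)) * NormedSpace.exp (G (Y q ω))).trace.re := by
      rw [Finset.sum_insert hq, add_comm]
      exact trace_exp_add_re_le (hsum s ω) (hG _)
    -- Each entry is dominated by the trace, and the trace by the integrable Golden–Thompson
    -- majorant.
    have hi : MatrixIntegrable (fun ω => NormedSpace.exp (∑ p ∈ insert q s, G (Y p ω))) P :=
      fun i j => hprod.re.mono' (hms _ i j).aestronglyMeasurable (Filter.Eventually.of_forall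
        fun ω => (norm_exp_apply_le_trace (hsum _ ω) i j).trans (hgt ω))
    have htri {t : Finset ι}
        (h : MatrixIntegrable (fun ω => NormedSpace.exp (∑ p ∈ t, G (Y p ω))) P) :
        Integrable (fun ω => (NormedSpace.exp (∑ p ∈ t, G (Y p ω))).trace.re) P :=
      (integrable_finsetSum Finset.univ fun i _ => h i i).re
    refine ⟨hi, ?_⟩
    calc ∫ ω, (NormedSpace.exp (∑ p ∈ insert q s, G (Y p ω))).trace.re ∂P
        ≤ ∫ ω, (NormedSpace.exp (∑ p ∈ s, G (Y p ω)) * NormedSpace.exp (G (Y q ω))).trace.re ∂P :=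
          integral_mono (htri hi) hprod.re hgt
      _ = ∫ ω, (NormedSpace.exp (∑ p ∈ s, G (Y p ω)) * C).trace.re ∂P := by
          have h1 := integral_re hprod
          have h2 := integral_re hconst
          simp only [RCLike.re_to_complex] at h1 h2
          rw [h1, h2, hE]
      _ ≤ ∫ ω, (NormedSpace.exp (∑ p ∈ s, G (Y p ω))).trace.re * matrixOpNorm C ∂P :=
          integral_mono hconst.re ((htri ihi).mul_const _) fun ω =>
            trace_exp_mul_re_le (hsum s ω) C
      _ ≤ _ := by
          rw [integral_mul_const, Finset.prod_insert hq]
          calc _ ≤ _ := mul_le_mul_of_nonneg_right ihb (matrixOpNorm_nonneg C)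
            _ = _ := by ring

end MatrixLaplace

/-! ### Application to the empirical covariance matrix. -/

theorem isHermitian_expRankOne_exponent {k : ℕ} (N : ℕ) (μ : ℝ) (v : Fin k → ℂ) :
    ((μ : ℂ) • ((N : ℂ)⁻¹ • (rankOne v - 1))).IsHermitian := by
  have h : (rankOne v).IsHermitian := by
    ext i j
    simp [rankOne, Matrix.vecMulVec_apply, mul_comm]
  rw [Matrix.IsHermitian, Matrix.conjTranspose_smul, Matrix.conjTranspose_smul,
    Matrix.conjTranspose_sub, h.eq, Matrix.conjTranspose_one]
  simp

theorem smul_empiricalCovariance_sub_one_eq_sum {N k : ℕ} (hN : 1 ≤ N) (μ : ℝ)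
    (X : Matrix (Fin N) (Fin k) ℂ) :
    (μ : ℂ) • (empiricalCovariance X - 1) =
      ∑ p, (μ : ℂ) • ((N : ℂ)⁻¹ • (rankOne (X.row p) - 1)) := by
  have hN0 : (N : ℂ) ≠ 0 := Nat.cast_ne_zero.2 (by lia)
  have h : Xᴴ * X = ∑ p, rankOne (X.row p) := by
    ext i j
    simp [Matrix.mul_apply, Matrix.sum_apply, rankOne, Matrix.vecMulVec_apply]
  rw [← Finset.smul_sum, ← Finset.smul_sum, Finset.sum_sub_distrib, ← h, empiricalCovariance,
    smul_sub (N : ℂ)⁻¹, Finset.sum_const, Finset.card_univ, Fintype.card_fin,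
    ← Nat.cast_smul_eq_nsmul ℂ, smul_smul, inv_mul_cancel₀ hN0, one_smul]

theorem mainTheorem5 {Ω : Type*} [MeasurableSpace Ω] (P : Measure Ω) [IsProbabilityMeasure P]
    (N k : ℕ) (hN : 1 ≤ N) (X : Ω → Matrix (Fin N) (Fin k) ℂ)
    (hX : ∀ p j, Measurable fun ω => X ω p j)
    (hindep : iIndepFun (fun (p : Fin N) (ω : Ω) => (X ω).row p) P) (μ : ℝ) :
    (∫⁻ ω, ENNReal.ofReal (traceExpCov μ (X ω)) ∂P ≤
      (k : ℝ≥0∞) * ∏ p : Fin N, expectationOpNorm (fun ω => expRankOne N μ ((X ω).row p)) P) ∧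
    ((∀ p : Fin N, MatrixIntegrable (fun ω => expRankOne N μ ((X ω).row p)) P) →
      Integrable (fun ω => traceExpCov μ (X ω)) P ∧
      ∫ ω, traceExpCov μ (X ω) ∂P ≤
        (k : ℝ) * ∏ p : Fin N,
          matrixOpNorm (matrixExpectation (fun ω => expRankOne N μ ((X ω).row p)) P)) := by
  have hreal : (∀ p : Fin N, MatrixIntegrable (fun ω => expRankOne N μ ((X ω).row p)) P) →
      Integrable (fun ω => traceExpCov μ (X ω)) P ∧
      ∫ ω, traceExpCov μ (X ω) ∂P ≤
        (k : ℝ) * ∏ p : Fin N,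
          matrixOpNorm (matrixExpectation (fun ω => expRankOne N μ ((X ω).row p)) P) := by
    intro hint
    have hGm (i j : Fin k) : Measurable fun v : Fin k → ℂ =>
        ((μ : ℂ) • ((N : ℂ)⁻¹ • (rankOne v - 1))) i j := by
      simp only [Matrix.smul_apply, Matrix.sub_apply, rankOne, Matrix.vecMulVec_apply,
        Pi.star_apply, smul_eq_mul]
      have hc : Continuous fun v : Fin k → ℂ =>
          (μ : ℂ) * ((N : ℂ)⁻¹ * (star (v i) * v j - (1 : Matrix (Fin k) (Fin k) ℂ) i j)) := by
        fun_prop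
      exact hc.measurable
    obtain ⟨h1, h2⟩ := integral_trace_exp_sum_le
      (fun p => measurable_pi_lambda _ fun j => hX p j) hindep hGm
      (isHermitian_expRankOne_exponent N μ) hint Finset.univ
    simp only [traceExpCov, smul_empiricalCovariance_sub_one_eq_sum hN]
    exact ⟨(integrable_finsetSum Finset.univ fun i _ => h1 i i).re, h2⟩
  refine ⟨?_, hreal⟩
  by_cases hint : ∀ p : Fin N, MatrixIntegrable (fun ω => expRankOne N μ ((X ω).row p)) P
  · obtain ⟨h1, h2⟩ := hreal hint
    have h0 (ω : Ω) : 0 ≤ traceExpCov μ (X ω) := by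
      rw [traceExpCov, smul_empiricalCovariance_sub_one_eq_sum hN]
      exact Matrix.trace_exp_re_nonneg
        (isSelfAdjoint_sum _ fun p _ => isHermitian_expRankOne_exponent N μ _)
    rw [← ofReal_integral_eq_lintegral_ofReal h1 (Filter.Eventually.of_forall h0)]
    refine (ENNReal.ofReal_le_ofReal h2).trans_eq ?_
    rw [ENNReal.ofReal_mul (Nat.cast_nonneg k), ENNReal.ofReal_natCast,
      ENNReal.ofReal_prod_of_nonneg fun p _ => matrixOpNorm_nonneg _]
    simp only [expectationOpNorm, if_pos (hint _)]
  -- A non-integrable factor is `∞` and no other factor vanishes, so the right-hand side is `∞`,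
  -- except when `k = 0`, where the trace is `0`.
  · rcases eq_or_ne k 0 with rfl | hk
    · simp [traceExpCov, Matrix.trace]
    · push Not at hint
      obtain ⟨q, hq⟩ := hint
      have hpos (p : Fin N) :
          expectationOpNorm (fun ω => expRankOne N μ ((X ω).row p)) P ≠ 0 := by
        rw [expectationOpNorm]
        split_ifs with h
        · exact (ENNReal.ofReal_pos.2 (matrixOpNorm_matrixExpectation_exp_pos hk
            (fun ω => isHermitian_expRankOne_exponent N μ _) h)).ne'
        · simp
      rw [← Finset.mul_prod_erase _ _ (Finset.mem_univ q), expectationOpNorm, if_neg hq,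
        ENNReal.top_mul (Finset.prod_ne_zero_iff.2 fun p _ => hpos p),
        ENNReal.mul_top (Nat.cast_ne_zero.2 hk)]
      exact le_top
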